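/- Consider a GI/GI/1/1 system: a single server without a queue, fed by a renewal stream of packets with inter-arrival times $Z_n\ge 0$; a packet that arrives while the server is busy is discarded, any other packet is served at once. Number the served packets $k=0,1,2,\dots$ in the order of their departures, let $X_k\ge 0$ be the service time of packet $k$, $T_A(k)$ its arrival time and $T_D(k)=T_A(k)+X_k$ its departure time; packet $k+1$ is the first arrival after packet $k$ that does not come before $T_D(k)$. The $X_k$, $k\ge 0$, are identically distributed, the inter-arrival times from packet $0$ on are identically distributed, and all of them are mutually independent; $T_A(0)$ and the packets served before packet $0$ form an arbitrary initial condition. Let $\Delta(t)=t-\max\{T_A(n):T_D(n)\le t\}$ be the age of information (AoI), where $n$ also runs over the packets served before packet $0$, let $I_k=T_A(k)-T_D(k-1)$ be the idle time before the service of packet $k$, and for $d\ge 0$ and $k\ge 1$ let $$g(k)=\min\{(X_{k-1}+I_k+X_k-d)^+,\;X_k+I_k\},\qquad \nu=\frac{1}{\mathbb{E}[X_k]+\mathbb{E}[I_k]}.$$ Suppose that $\lambda=1/\mathbb{E}[Z]\in(0,\infty)$ and $0<\mathbb{E}[X]<\infty$. Then for every $d\ge 0$ and every $k\ge 1$ the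 random variables $I_k$ and $g(k)$ are integrable, and $$\lim_{T\to\infty}\frac1T\int_0^T \mathbf 1\{\Delta(t)>d\}\,dt=\nu\,\mathbb{E}[g(k)]\quad\text{almost surely;}$$ moreover, if the violation probability $\mathbb{P}(\Delta>d)=\lim_{t\to\infty}\mathbb{P}(\Delta(t)>d)$ exists, then $$\mathbb{P}(\Delta>d)=\nu\,\mathbb{E}[g(k)].$$ This holds whatever the initial condition is, in particular for a stationary and ergodic AoI process. -/

import Mathlib

open MeasureTheory ProbabilityTheory Filter Topology

/-- A GI/GI/1/1 system on a probability space: a single server, no queue, a renewal stream of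
arrivals with i.i.d. inter-arrival times, and i.i.d. service times. Served packets are numbered
in the order of their departures by `k = 0, 1, 2, …`. Packet `0` arrives at the random time
`firstArrival`. What happened before is an arbitrary initial condition: packet `-(j+1)`,
`j = 0, 1, 2, …`, was in service from `pastArrival j` to `pastDeparture j`. No stationarity and
no independence between this past and the future is required, so that the system may be started
in any way, in particular in its stationary regime. -/
structure GIGI11System {Ω : Type*} [MeasurableSpace Ω] (μ : Measure Ω) where
  /-- `X k` is the service time of packet `k`. -/
  X : ℕ → Ω → ℝ
  /-- `Z n` is the time between the `n`-th and the `(n+1)`-st arrival of the stream, served or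
  discarded; the `0`-th arrival is that of packet `0`. -/
  Z : ℕ → Ω → ℝ
  /-- The arrival time of packet `0`. -/
  firstArrival : Ω → ℝ
  /-- The arrival time of packet `-(j+1)`. -/
  pastArrival : ℕ → Ω → ℝ
  /-- The departure time of packet `-(j+1)`. -/
  pastDeparture : ℕ → Ω → ℝ
  measurable_X : ∀ k, Measurable (X k)
  measurable_Z : ∀ n, Measurable (Z n)
  measurable_firstArrival : Measurable firstArrival
  measurable_pastArrival : ∀ j, Measurable (pastArrival j)
  measurable_pastDeparture : ∀ j, Measurable (pastDeparture j)
  X_nonneg : ∀ k, ∀ᵐ ω ∂μ, 0 ≤ X k ω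
  Z_nonneg : ∀ n, ∀ᵐ ω ∂μ, 0 ≤ Z n ω
  /-- All service times and all inter-arrival times are mutually independent. -/
  indep : iIndepFun (Sum.elim X Z : ℕ ⊕ ℕ → Ω → ℝ) μ
  identDistrib_X : ∀ k, IdentDistrib (X k) (X 0) μ μ
  identDistrib_Z : ∀ n, IdentDistrib (Z n) (Z 0) μ μ
  /-- In the past, too, packets were served one after the other, from their arrival on. -/
  pastArrival_le : ∀ j, ∀ᵐ ω ∂μ, pastArrival j ω ≤ pastDeparture j ω
  pastDeparture_zero_le : ∀ᵐ ω ∂μ, pastDeparture 0 ω ≤ firstArrival ω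
  pastDeparture_succ_le : ∀ j, ∀ᵐ ω ∂μ, pastDeparture (j + 1) ω ≤ pastArrival j ω

namespace GIGI11System

noncomputable section

variable {Ω : Type*} [MeasurableSpace Ω] {μ : Measure Ω} (S : GIGI11System μ)

/-- The mean arrival rate `λ = 1 / E[Z]`. -/
def arrivalRate : ℝ := 1 / ∫ ω, S.Z 0 ω ∂μ

/-- The time of the `n`-th arrival of the stream (served or discarded). -/
def streamArrival (n : ℕ) (ω : Ω) : ℝ :=
  S.firstArrival ω + ∑ i ∈ Finset.range n, S.Z i ω

/-- The position of packet `k` in the arrival stream. All arrivals that find the server busy are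
discarded, so that packet `k + 1` is the first arrival after packet `k` that does not come before
the departure of packet `k`. -/
def streamIndex : ℕ → Ω → ℕ
  | 0, _ => 0
  | k + 1, ω => sInf {n : ℕ | streamIndex k ω < n ∧
      S.streamArrival (streamIndex k ω) ω + S.X k ω ≤ S.streamArrival n ω}

/-- `T_A(k)`, the arrival time of packet `k`; its service starts at once. -/
def arrivalTime (k : ℕ) (ω : Ω) : ℝ := S.streamArrival (S.streamIndex k ω) ω

/-- `T_D(k)`, the departure time of packet `k`. -/
def departureTime (k : ℕ) (ω : Ω) : ℝ := S.arrivalTime k ω + S.X k ω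

/-- `I_k`, the idle time just before the service of packet `k` (used for `k ≥ 1`). -/
def idleTime (k : ℕ) (ω : Ω) : ℝ := S.arrivalTime k ω - S.departureTime (k - 1) ω

/-- The age of information `Δ(t) = t - max {T_A(n) : T_D(n) ≤ t}`, where `n` runs over all
packets, those of the past included. -/
def age (t : ℝ) (ω : Ω) : ℝ :=
  t - sSup ({s : ℝ | ∃ n : ℕ, S.departureTime n ω ≤ t ∧ s = S.arrivalTime n ω} ∪
    {s : ℝ | ∃ j : ℕ, S.pastDeparture j ω ≤ t ∧ s = S.pastArrival j ω})

/-- The violation probability `lim_{t → ∞} P(Δ(t) > d)` exists and is equal to `p`. -/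
def HasViolationProbability (d p : ℝ) : Prop :=
  Tendsto (fun t : ℝ => μ.real {ω | d < S.age t ω}) atTop (𝓝 p)

/-- `g(k) = min {(X_{k-1} + I_k + X_k - d)^+, X_k + I_k}` (used for `k ≥ 1`). -/
def g (d : ℝ) (k : ℕ) (ω : Ω) : ℝ :=
  min (max 0 (S.X (k - 1) ω + S.idleTime k ω + S.X k ω - d)) (S.X k ω + S.idleTime k ω)

/-- `ν = 1 / (E[X_k] + E[I_k])` (used for `k ≥ 1`). -/
def departureRate (k : ℕ) : ℝ := 1 / ((∫ ω, S.X k ω ∂μ) + ∫ ω, S.idleTime k ω ∂μ)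

end

end GIGI11System

/-! The system regenerates at each served arrival. The event that packet `k` is the `n`-th arrival
of the stream is decided by the first `k` service times and the first `n` inter-arrival times, so
the data after that arrival are independent of what precedes and have the original law
(`Regular.measure_inter_future`). The triple of `X_k`, `X_{k+1}`, `I_{k+1}` is a fixed functional of
these data. Such triples are therefore identically distributed, and independent once their indices
differ by two; adjacent ones share a service time. The strong law, applied to even and odd indices
separately, covers every integrable function of the triple.

Between the departures of packets `k-1` and `k` the age is `t - T_A(k-1)`. It exceeds `d` there for
a time `g(k)`, out of a total `X_k + I_k`. Renewal-reward (`tendsto_div_of_renewal_reward`) turns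
the two strong laws into the almost sure limit. The initial condition only affects times before the
departure of packet `0`.

Integrability of `I_k` comes from Wald's identity, used twice: with `min Z 1` it bounds the mean
number of arrivals in a cycle, with `Z` it then bounds the mean cycle.

If the violation probability converges, its time averages have the same limit; by Fubini and
dominated convergence they also tend to the almost sure limit. -/

theorem measurable_sInf_nat {α : Type*} [MeasurableSpace α] {p : α → ℕ → Prop}
    (hp : ∀ n, MeasurableSet {a | p a n}) : Measurable fun a => sInf {n | p a n} := by
  -- Since `sInf ∅ = 0`, only a nonzero value certifies that the infimum is attained. The level set
  -- of `0` is recovered at the end as a complement.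
  have key : ∀ a n, n ≠ 0 → (sInf {n | p a n} = n ↔ p a n ∧ ∀ m < n, ¬ p a m) := by
    intro a n hn
    constructor
    · intro h
      have hne : {n | p a n}.Nonempty := Nat.nonempty_of_sInf_eq_succ
        (k := n - 1) (by omega)
      refine ⟨?_, fun m hm hpm => ?_⟩
      · have := Nat.sInf_mem hne
        rwa [h] at this
      · have := Nat.sInf_le (s := {n | p a n}) hpm
        omega
    · rintro ⟨h1, h2⟩
      refine le_antisymm (Nat.sInf_le h1) ?_
      by_contra! hlt
      exact h2 _ hlt (Nat.sInf_mem (s := {n | p a n}) ⟨n, h1⟩)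
  have hpos : ∀ n, n ≠ 0 → MeasurableSet {a | sInf {n | p a n} = n} := by
    intro n hn
    simp only [key _ n hn, Set.ofPred_and, Set.ofPred_forall]
    exact (hp n).inter (MeasurableSet.iInter fun m => MeasurableSet.iInter fun _ => (hp m).compl)
  refine measurable_to_countable' fun n => ?_
  rcases eq_or_ne n 0 with rfl | hn
  · have : (fun a => sInf {n | p a n}) ⁻¹' {0} =
        (⋃ n ∈ {n : ℕ | n ≠ 0}, {a | sInf {n | p a n} = n})ᶜ := by
      ext a
      simp only [Set.mem_preimage, Set.mem_singleton_iff, Set.mem_compl_iff, Set.mem_iUnion,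
        Set.mem_ofPred_eq, exists_prop, not_exists, not_and]
      exact ⟨fun h n hn h' => hn (h'.symm.trans h), fun h => by_contra fun h' => h _ h' rfl⟩
    rw [this]
    exact (MeasurableSet.biUnion (Set.to_countable _) fun n hn => hpos n hn).compl
  · exact hpos n hn

/-! ### Sample paths: the recursion for the served arrivals -/

namespace GIGI11System

noncomputable section

variable {Ω : Type*} [MeasurableSpace Ω] {μ : Measure Ω} (S : GIGI11System μ)

/-- The time from the arrival of packet `0` to the `n`-th arrival of the stream. -/
def renewal (n : ℕ) (ω : Ω) : ℝ := ∑ i ∈ Finset.range n, S.Z i ω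

/-- Nonnegative service and inter-arrival times, and infinitely many arrivals, spread over all of
the time axis. -/
structure RegularAt (ω : Ω) : Prop where
  X_nonneg : ∀ k, 0 ≤ S.X k ω
  Z_nonneg : ∀ n, 0 ≤ S.Z n ω
  tendsto_renewal : Tendsto (fun n => S.renewal n ω) atTop atTop

variable {S}

theorem streamArrival_eq (n : ℕ) (ω : Ω) :
    S.streamArrival n ω = S.firstArrival ω + S.renewal n ω := rfl

theorem RegularAt.renewal_mono {ω : Ω} (h : S.RegularAt ω) : Monotone fun n => S.renewal n ω :=
  monotone_nat_of_le_succ fun n => by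
    simp only [renewal, Finset.sum_range_succ]
    linarith [h.Z_nonneg n]

/-- Divergence of the renewal sequence makes the set of candidates nonempty, so the infimum is a
true minimum and not the default `0`. `firstArrival` cancels, so the indices depend on service and
inter-arrival times alone. -/
theorem RegularAt.streamIndex_succ_eq_iff {ω : Ω} (h : S.RegularAt ω) (k n : ℕ) :
    S.streamIndex (k + 1) ω = n ↔ (S.streamIndex k ω < n ∧
      S.renewal (S.streamIndex k ω) ω + S.X k ω ≤ S.renewal n ω) ∧
      ∀ m < n, ¬ (S.streamIndex k ω < m ∧
        S.renewal (S.streamIndex k ω) ω + S.X k ω ≤ S.renewal m ω) := by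
  have hset : S.streamIndex (k + 1) ω = sInf {n : ℕ | S.streamIndex k ω < n ∧
      S.renewal (S.streamIndex k ω) ω + S.X k ω ≤ S.renewal n ω} := by
    rw [streamIndex]
    simp only [streamArrival_eq, add_assoc, add_le_add_iff_left]
  have hne : {n : ℕ | S.streamIndex k ω < n ∧
      S.renewal (S.streamIndex k ω) ω + S.X k ω ≤ S.renewal n ω}.Nonempty :=
    ((eventually_gt_atTop _).and (h.tendsto_renewal.eventually_ge_atTop _)).exists
  rw [hset]
  constructor
  · rintro rfl
    exact ⟨Nat.sInf_mem hne, fun m hm => Nat.notMem_of_lt_sInf hm⟩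
  · rintro ⟨h1, h2⟩
    refine le_antisymm (Nat.sInf_le h1) ?_
    by_contra! hlt
    exact h2 _ hlt (Nat.sInf_mem hne)

theorem RegularAt.streamIndex_lt_succ {ω : Ω} (h : S.RegularAt ω) (k : ℕ) :
    S.streamIndex k ω < S.streamIndex (k + 1) ω :=
  ((h.streamIndex_succ_eq_iff k _).1 rfl).1.1

theorem RegularAt.strictMono_streamIndex {ω : Ω} (h : S.RegularAt ω) :
    StrictMono fun k => S.streamIndex k ω :=
  strictMono_nat_of_lt_succ h.streamIndex_lt_succ

theorem idleTime_succ (k : ℕ) (ω : Ω) : S.idleTime (k + 1) ω =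
    S.renewal (S.streamIndex (k + 1) ω) ω - S.renewal (S.streamIndex k ω) ω - S.X k ω := by
  simp only [idleTime, departureTime, arrivalTime, streamArrival_eq, Nat.add_sub_cancel]
  ring

theorem RegularAt.idleTime_succ_nonneg {ω : Ω} (h : S.RegularAt ω) (k : ℕ) :
    0 ≤ S.idleTime (k + 1) ω := by
  have := ((h.streamIndex_succ_eq_iff k _).1 rfl).1.2
  rw [idleTime_succ]
  linarith

/-! ### Service cycles as functionals of the future -/

variable (S)

/-- The service times from packet `k` on and the inter-arrival times from the `n`-th arrival on. -/
def future (k n : ℕ) (ω : Ω) : ℕ ⊕ ℕ → ℝ :=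
  fun i => (Sum.elim S.X S.Z : ℕ ⊕ ℕ → Ω → ℝ) (Sum.map (k + ·) (n + ·) i) ω

/-- The number of arrivals in a service cycle, as a functional of the service and inter-arrival
times from its beginning on. -/
def cycleLength (w : ℕ ⊕ ℕ → ℝ) : ℕ :=
  sInf {n : ℕ | 0 < n ∧ w (Sum.inl 0) ≤ ∑ j ∈ Finset.range n, w (Sum.inr j)}

/-- Service time, next service time and the idle time between them, as a functional of the service
and inter-arrival times. -/
def cycleOf (w : ℕ ⊕ ℕ → ℝ) : ℝ × ℝ × ℝ :=
  (w (Sum.inl 0), w (Sum.inl 1),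
    ∑ j ∈ Finset.range (cycleLength w), w (Sum.inr j) - w (Sum.inl 0))

/-- The service time of packet `k`, that of packet `k + 1`, and the idle time between them. -/
def cycle (k : ℕ) (ω : Ω) : ℝ × ℝ × ℝ := (S.X k ω, S.X (k + 1) ω, S.idleTime (k + 1) ω)

variable {S}

theorem renewal_add (a n : ℕ) (ω : Ω) :
    S.renewal (a + n) ω = S.renewal a ω + ∑ j ∈ Finset.range n, S.Z (a + j) ω :=
  Finset.sum_range_add _ _ _

/-- The search for the next served arrival, recentred at packet `k`, is the search made from packet
`0` with shifted data. This is the pathwise form of regeneration. -/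
theorem RegularAt.streamIndex_succ {ω : Ω} (h : S.RegularAt ω) (k : ℕ) :
    S.streamIndex (k + 1) ω =
      S.streamIndex k ω + cycleLength (S.future k (S.streamIndex k ω) ω) := by
  set a := S.streamIndex k ω with ha
  have hset : {n : ℕ | 0 < n ∧ S.future k a ω (Sum.inl 0) ≤
      ∑ j ∈ Finset.range n, S.future k a ω (Sum.inr j)} =
      {n : ℕ | a < a + n ∧ S.renewal a ω + S.X k ω ≤ S.renewal (a + n) ω} := by
    ext n
    simp [future, renewal_add]
  have hne : {n : ℕ | a < a + n ∧ S.renewal a ω + S.X k ω ≤ S.renewal (a + n) ω}.Nonempty := by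
    have h1 : Tendsto (fun n => S.renewal (a + n) ω) atTop atTop :=
      h.tendsto_renewal.comp (tendsto_atTop_mono (fun n => Nat.le_add_left n a) tendsto_id)
    refine (((eventually_gt_atTop 0).and
      (h1.eventually_ge_atTop (S.renewal a ω + S.X k ω))).mono fun n hn => ?_).exists
    exact ⟨by have := hn.1; omega, hn.2⟩
  rw [cycleLength, hset, h.streamIndex_succ_eq_iff, ← ha]
  refine ⟨Nat.sInf_mem hne, fun m hm hm' => ?_⟩
  obtain ⟨c, rfl⟩ := Nat.exists_eq_add_of_lt hm'.1
  have hc : c + 1 < sInf {n : ℕ | a < a + n ∧ S.renewal a ω + S.X k ω ≤ S.renewal (a + n) ω} := by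
    omega
  exact Nat.notMem_of_lt_sInf hc hm'

theorem RegularAt.cycle_eq {ω : Ω} (h : S.RegularAt ω) (k : ℕ) :
    S.cycle k ω = cycleOf (S.future k (S.streamIndex k ω) ω) := by
  rw [cycle, idleTime_succ, h.streamIndex_succ, renewal_add]
  simp [cycleOf, future]

theorem measurable_cycleLength : Measurable cycleLength := by
  refine measurable_sInf_nat fun n => ?_
  have h : Measurable fun w : ℕ ⊕ ℕ → ℝ => ∑ j ∈ Finset.range n, w (Sum.inr j) := by fun_prop
  exact (MeasurableSet.const _).inter (measurableSet_le (measurable_pi_apply _) h)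

theorem measurable_sum_range_comp {α : Type*} [MeasurableSpace α] {f : ℕ → α → ℝ} {N : α → ℕ}
    (hf : ∀ n, Measurable (f n)) (hN : Measurable N) :
    Measurable fun a => ∑ j ∈ Finset.range (N a), f j a := by
  have : Measurable fun p : ℕ × α => ∑ j ∈ Finset.range p.1, f j p.2 :=
    measurable_from_prod_countable_right fun n => by
      simpa using Finset.measurable_fun_sum _ fun j _ => hf j
  exact this.comp (hN.prodMk measurable_id)

theorem measurable_cycleOf : Measurable cycleOf := by
  have := measurable_sum_range_comp (f := fun j (w : ℕ ⊕ ℕ → ℝ) => w (Sum.inr j))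
    (fun n => by fun_prop) measurable_cycleLength
  unfold cycleOf
  fun_prop

theorem measurable_sum_elim (i : ℕ ⊕ ℕ) :
    Measurable ((Sum.elim S.X S.Z : ℕ ⊕ ℕ → Ω → ℝ) i) := by
  cases i with
  | inl k => exact S.measurable_X k
  | inr n => exact S.measurable_Z n

theorem measurable_future (k n : ℕ) : Measurable (S.future k n) :=
  measurable_pi_lambda _ fun _ => measurable_sum_elim _

/-! ### Independence of past and future, stationarity of the future -/

variable (S)

/-- The σ-algebra generated by the first `k` service times and the first `n` inter-arrival
times. -/
abbrev past (k n : ℕ) : MeasurableSpace Ω :=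
  ⨆ i ∈ (Sum.inl '' Set.Iio k ∪ Sum.inr '' Set.Iio n : Set (ℕ ⊕ ℕ)),
    MeasurableSpace.comap ((Sum.elim S.X S.Z : ℕ ⊕ ℕ → Ω → ℝ) i) inferInstance

variable {S}

theorem past_mono {k k' n n' : ℕ} (hk : k ≤ k') (hn : n ≤ n') : S.past k n ≤ S.past k' n' :=
  biSup_mono fun _ hi => Set.union_subset_union
    (Set.image_mono (Set.Iio_subset_Iio hk)) (Set.image_mono (Set.Iio_subset_Iio hn)) hi

theorem past_le (k n : ℕ) : S.past k n ≤ ‹MeasurableSpace Ω› :=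
  iSup₂_le fun i _ => (measurable_sum_elim i).comap_le

theorem measurable_X_past {i k n : ℕ} (hi : i < k) : Measurable[S.past k n] (S.X i) := by
  have h : MeasurableSpace.comap ((Sum.elim S.X S.Z : ℕ ⊕ ℕ → Ω → ℝ) (Sum.inl i)) inferInstance
      ≤ S.past k n :=
    le_biSup (fun i => MeasurableSpace.comap ((Sum.elim S.X S.Z : ℕ ⊕ ℕ → Ω → ℝ) i) inferInstance)
      (Or.inl ⟨i, hi, rfl⟩)
  exact (comap_measurable _).mono h le_rfl

theorem measurable_Z_past {i k n : ℕ} (hi : i < n) : Measurable[S.past k n] (S.Z i) := by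
  have h : MeasurableSpace.comap ((Sum.elim S.X S.Z : ℕ ⊕ ℕ → Ω → ℝ) (Sum.inr i)) inferInstance
      ≤ S.past k n :=
    le_biSup (fun i => MeasurableSpace.comap ((Sum.elim S.X S.Z : ℕ ⊕ ℕ → Ω → ℝ) i) inferInstance)
      (Or.inr ⟨i, hi, rfl⟩)
  exact (comap_measurable _).mono h le_rfl

theorem measurable_renewal_past {a k n : ℕ} (ha : a ≤ n) :
    Measurable[S.past k n] (S.renewal a) :=
  Finset.measurable_fun_sum _ fun _ hi => measurable_Z_past ((Finset.mem_range.1 hi).trans_le ha)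

/-- The shifted coordinates avoid the index set that generates the past, and disjoint blocks of an
independent family are independent. -/
theorem indep_past_future (k n : ℕ) :
    Indep (S.past k n) (MeasurableSpace.comap (S.future k n) inferInstance) μ := by
  have h1 := indep_iSup_of_disjoint (fun i => (measurable_sum_elim (S := S) i).comap_le)
    S.indep.iIndep (S := (Sum.inl '' Set.Iio k ∪ Sum.inr '' Set.Iio n : Set (ℕ ⊕ ℕ)))
    disjoint_compl_right
  refine indep_of_indep_of_le_right h1 ?_
  rw [MeasurableSpace.pi, MeasurableSpace.comap_iSup]
  refine iSup_le fun i => ?_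
  rw [MeasurableSpace.comap_comp]
  refine le_biSup (fun i => MeasurableSpace.comap
    ((Sum.elim S.X S.Z : ℕ ⊕ ℕ → Ω → ℝ) i) inferInstance) (i := Sum.map (k + ·) (n + ·) i) ?_
  cases i <;> simp

/-- The shift is injective and keeps service and inter-arrival times apart, so every future has the
same infinite product law. -/
theorem identDistrib_future [IsProbabilityMeasure μ] (k n : ℕ) :
    IdentDistrib (S.future k n) (S.future 0 0) μ μ := by
  have hlaw : ∀ k n, μ.map (S.future k n) = Measure.infinitePi fun i : ℕ ⊕ ℕ =>
      Sum.elim (fun _ => μ.map (S.X 0)) (fun _ => μ.map (S.Z 0)) i := by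
    intro k n
    have hinj : Function.Injective (Sum.map (k + ·) (n + ·) : ℕ ⊕ ℕ → ℕ ⊕ ℕ) :=
      (add_right_injective k).sumMap (add_right_injective n)
    refine ((iIndepFun_iff_map_fun_eq_infinitePi_map fun i => measurable_sum_elim _).1
      (S.indep.precomp hinj)).trans ?_
    congr 1
    ext1 i
    cases i with
    | inl i => exact (S.identDistrib_X _).map_eq
    | inr i => exact (S.identDistrib_Z _).map_eq
  exact ⟨(measurable_future k n).aemeasurable, (measurable_future 0 0).aemeasurable,
    (hlaw k n).trans (hlaw 0 0).symm⟩

/-! ### Strong Markov property and independence of cycles -/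

variable (S) in
/-- Regularity at every sample point. -/
def Regular : Prop := ∀ ω, S.RegularAt ω

/-- The stopping property: once the index `a` of the preceding served packet is known, it suffices
to compare the arrivals up to the `n`-th with the threshold `renewal a + X k`. -/
theorem Regular.measurableSet_streamIndex_eq (h : S.Regular) (k n : ℕ) :
    MeasurableSet[S.past k n] {ω | S.streamIndex k ω = n} := by
  induction k generalizing n with
  | zero => simp only [streamIndex]; exact MeasurableSet.const _
  | succ k ih =>
    have : {ω | S.streamIndex (k + 1) ω = n} = ⋃ a ∈ Set.Iio n, {ω | S.streamIndex k ω = a} ∩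
        ({ω | S.renewal a ω + S.X k ω ≤ S.renewal n ω} ∩ ⋂ m ∈ Set.Ioo a n,
          {ω | S.renewal m ω < S.renewal a ω + S.X k ω}) := by
      ext ω
      simp only [Set.mem_ofPred_eq, (h ω).streamIndex_succ_eq_iff, Set.mem_iUnion, Set.mem_inter_iff,
        Set.mem_iInter, Set.mem_Iio, Set.mem_Ioo]
      constructor
      · rintro ⟨⟨h1, h2⟩, h3⟩
        refine ⟨_, h1, rfl, h2, fun m hm => ?_⟩
        by_contra! hle
        exact h3 m hm.2 ⟨hm.1, hle⟩
      · rintro ⟨a, ha, rfl, h2, h3⟩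
        exact ⟨⟨ha, h2⟩, fun m hm hm' => (h3 m ⟨hm'.1, hm⟩).not_ge hm'.2⟩
    rw [this]
    refine MeasurableSet.biUnion (Set.to_countable _) fun a ha => ?_
    have ha' : a ≤ n := le_of_lt ha
    have hR : Measurable[S.past (k + 1) n] fun ω => S.renewal a ω + S.X k ω :=
      (measurable_renewal_past ha').add (measurable_X_past k.lt_succ_self)
    refine MeasurableSet.inter (past_mono k.le_succ ha' _ (ih a)) (MeasurableSet.inter ?_ ?_)
    · exact measurableSet_le hR (measurable_renewal_past le_rfl)
    · exact MeasurableSet.biInter (Set.to_countable _) fun m hm =>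
        measurableSet_lt (measurable_renewal_past hm.2.le) hR

theorem Regular.measurable_streamIndex (h : S.Regular) (k : ℕ) : Measurable (S.streamIndex k) :=
  measurable_to_countable' fun n => past_le k n _ (h.measurableSet_streamIndex_eq k n)

/-- Cycle `i` uses the service times `i` and `i + 1` and inter-arrival times before the arrival of
packet `i + 1`. All of these belong to the past of packet `k` exactly because `i + 1 < k`. -/
theorem Regular.measurableSet_cycle_inter (h : S.Regular) {i k : ℕ} (hik : i + 2 ≤ k) (n : ℕ)
    {B : Set (ℝ × ℝ × ℝ)} (hB : MeasurableSet B) :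
    MeasurableSet[S.past k n] (S.cycle i ⁻¹' B ∩ {ω | S.streamIndex k ω = n}) := by
  have : S.cycle i ⁻¹' B ∩ {ω | S.streamIndex k ω = n} = ⋃ a ∈ Set.Iio n, ⋃ b ∈ Set.Iio n,
      {ω | S.streamIndex i ω = a} ∩ {ω | S.streamIndex (i + 1) ω = b} ∩
        (fun ω => (S.X i ω, S.X (i + 1) ω, S.renewal b ω - S.renewal a ω - S.X i ω)) ⁻¹' B ∩
        {ω | S.streamIndex k ω = n} := by
    ext ω
    simp only [Set.mem_inter_iff, Set.mem_preimage, cycle, idleTime_succ, Set.mem_ofPred_eq,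
      Set.mem_iUnion, Set.mem_Iio]
    constructor
    · rintro ⟨h1, h2⟩
      exact ⟨_, h2 ▸ (h ω).strictMono_streamIndex (by omega : i < k), _,
        h2 ▸ (h ω).strictMono_streamIndex (by omega : i + 1 < k), ⟨⟨rfl, rfl⟩, h1⟩, h2⟩
    · rintro ⟨a, ha, b, hb, ⟨⟨rfl, rfl⟩, h1⟩, h2⟩
      exact ⟨h1, h2⟩
  rw [this]
  refine MeasurableSet.biUnion (Set.to_countable _) fun a ha => ?_
  refine MeasurableSet.biUnion (Set.to_countable _) fun b hb => ?_
  have ha' : a ≤ n := le_of_lt ha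
  have hb' : b ≤ n := le_of_lt hb
  have hX := measurable_X_past (S := S) (n := n) (by omega : i < k)
  refine (((past_mono (by omega) ha' _ (h.measurableSet_streamIndex_eq i a)).inter
    (past_mono (by omega) hb' _ (h.measurableSet_streamIndex_eq (i + 1) b))).inter ?_).inter
    (h.measurableSet_streamIndex_eq k n)
  exact (hX.prodMk ((measurable_X_past (by omega)).prodMk
    (((measurable_renewal_past hb').sub (measurable_renewal_past ha')).sub hX))) hB

/-- The strong Markov property at the arrival of packet `k`. -/
theorem Regular.measure_inter_future [IsProbabilityMeasure μ] (h : S.Regular) (k : ℕ) {A : Set Ω}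
    (hA : ∀ n, MeasurableSet[S.past k n] (A ∩ {ω | S.streamIndex k ω = n}))
    {C : Set (ℕ ⊕ ℕ → ℝ)} (hC : MeasurableSet C) :
    μ (A ∩ {ω | S.future k (S.streamIndex k ω) ω ∈ C}) = μ A * μ (S.future 0 0 ⁻¹' C) := by
  have hsplit : ∀ B : Set Ω, MeasurableSet B →
      μ B = ∑' n, μ (B ∩ {ω | S.streamIndex k ω = n}) := by
    intro B hB
    rw [← measure_iUnion]
    · congr 1
      ext ω
      simp
    · intro m n hmn
      refine Set.disjoint_left.2 fun ω h1 h2 => hmn ?_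
      exact h1.2.symm.trans h2.2
    · exact fun n => hB.inter (h.measurable_streamIndex k (measurableSet_singleton n))
  have hAm : MeasurableSet A := by
    have : A = ⋃ n, A ∩ {ω | S.streamIndex k ω = n} := by
      ext ω
      simp
    rw [this]
    exact MeasurableSet.iUnion fun n => past_le k n _ (hA n)
  have hF : Measurable fun ω => S.future k (S.streamIndex k ω) ω := by
    have : Measurable fun p : ℕ × Ω => S.future k p.1 p.2 :=
      measurable_from_prod_countable_right fun n => measurable_future k n
    exact this.comp ((h.measurable_streamIndex k).prodMk measurable_id)
  have hFC : MeasurableSet {ω | S.future k (S.streamIndex k ω) ω ∈ C} := hF hC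
  rw [hsplit _ (hAm.inter hFC), hsplit A hAm, ← ENNReal.tsum_mul_right]
  refine tsum_congr fun n => ?_
  -- On each level set of the index the random shift is a deterministic one, to which the
  -- independence of past and future applies.
  have : A ∩ {ω | S.future k (S.streamIndex k ω) ω ∈ C} ∩ {ω | S.streamIndex k ω = n} =
      A ∩ {ω | S.streamIndex k ω = n} ∩ S.future k n ⁻¹' C := by
    ext ω
    simp only [Set.mem_inter_iff, Set.mem_ofPred_eq, Set.mem_preimage]
    constructor
    · rintro ⟨⟨h1, h2⟩, rfl⟩; exact ⟨⟨h1, rfl⟩, h2⟩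
    · rintro ⟨⟨h1, rfl⟩, h2⟩; exact ⟨⟨h1, h2⟩, rfl⟩
  rw [this, ((Indep_iff _ _ _).1 (indep_past_future k n)) _ _ (hA n) ⟨C, hC, rfl⟩,
    (identDistrib_future k n).measure_mem_eq hC]

theorem Regular.measurable_cycle (h : S.Regular) (k : ℕ) : Measurable (S.cycle k) := by
  have : Measurable fun p : ℕ × Ω => S.future k p.1 p.2 :=
    measurable_from_prod_countable_right fun n => measurable_future k n
  have h2 := measurable_cycleOf.comp
    (this.comp ((h.measurable_streamIndex k).prodMk measurable_id))
  convert h2 using 1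
  ext1 ω
  exact (h ω).cycle_eq k

theorem Regular.preimage_cycle (h : S.Regular) (k : ℕ) (B : Set (ℝ × ℝ × ℝ)) :
    S.cycle k ⁻¹' B = {ω | S.future k (S.streamIndex k ω) ω ∈ cycleOf ⁻¹' B} := by
  ext ω
  simp [(h ω).cycle_eq]

theorem Regular.measure_inter_cycle [IsProbabilityMeasure μ] (h : S.Regular) (k : ℕ) {A : Set Ω}
    (hA : ∀ n, MeasurableSet[S.past k n] (A ∩ {ω | S.streamIndex k ω = n}))
    {B : Set (ℝ × ℝ × ℝ)} (hB : MeasurableSet B) :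
    μ (A ∩ S.cycle k ⁻¹' B) = μ A * μ (S.cycle k ⁻¹' B) := by
  have h0 := h.measure_inter_future k (A := Set.univ)
    (fun n => by simpa using h.measurableSet_streamIndex_eq k n) (measurable_cycleOf hB)
  rw [h.preimage_cycle, h.measure_inter_future k hA (measurable_cycleOf hB)]
  rw [Set.univ_inter, measure_univ, one_mul] at h0
  rw [h0]

theorem Regular.identDistrib_cycle [IsProbabilityMeasure μ] (h : S.Regular) (k : ℕ) :
    IdentDistrib (S.cycle k) (S.cycle 0) μ μ := by
  have key : ∀ k B, MeasurableSet B →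
      μ (S.cycle k ⁻¹' B) = μ (S.future 0 0 ⁻¹' (cycleOf ⁻¹' B)) := by
    intro k B hB
    have h0 := h.measure_inter_future k (A := Set.univ)
      (fun n => by simpa using h.measurableSet_streamIndex_eq k n) (measurable_cycleOf hB)
    rwa [Set.univ_inter, measure_univ, one_mul, ← h.preimage_cycle] at h0
  refine ⟨(h.measurable_cycle k).aemeasurable, (h.measurable_cycle 0).aemeasurable, ?_⟩
  ext B hB
  rw [Measure.map_apply (h.measurable_cycle k) hB, Measure.map_apply (h.measurable_cycle 0) hB,
    key k B hB, key 0 B hB]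

theorem Regular.indepFun_cycle [IsProbabilityMeasure μ] (h : S.Regular) {i k : ℕ}
    (hik : i + 2 ≤ k) : IndepFun (S.cycle i) (S.cycle k) μ :=
  indepFun_iff_measure_inter_preimage_eq_mul.2 fun _ _ hB hC =>
    h.measure_inter_cycle k (fun n => h.measurableSet_cycle_inter hik n hB) hC

end

end GIGI11System

/-! ### A strong law for one-dependent sequences -/

theorem tendsto_average_of_even_odd {u : ℕ → ℝ} {m : ℝ}
    (he : Tendsto (fun n : ℕ => (∑ i ∈ Finset.range n, u (2 * i)) / n) atTop (𝓝 m))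
    (ho : Tendsto (fun n : ℕ => (∑ i ∈ Finset.range n, u (2 * i + 1)) / n) atTop (𝓝 m)) :
    Tendsto (fun n : ℕ => (∑ i ∈ Finset.range n, u i) / n) atTop (𝓝 m) := by
  have hsum : ∀ n, ∑ i ∈ Finset.range n, u i =
      ∑ i ∈ Finset.range ((n + 1) / 2), u (2 * i) + ∑ i ∈ Finset.range (n / 2), u (2 * i + 1) := by
    intro n
    induction n with
    | zero => simp
    | succ n ih =>
      rw [Finset.sum_range_succ, ih]
      rcases Nat.even_or_odd' n with ⟨c, rfl | rfl⟩
      · rw [show (2 * c + 1 + 1) / 2 = c + 1 by omega, show (2 * c + 1) / 2 = c by omega,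
          show 2 * c / 2 = c by omega, Finset.sum_range_succ]
        ring
      · rw [show (2 * c + 1 + 1 + 1) / 2 = c + 1 by omega, show (2 * c + 1 + 1) / 2 = c + 1 by omega,
          show (2 * c + 1) / 2 = c by omega, Finset.sum_range_succ (fun i => u (2 * i + 1))]
        ring
  have hhalf : ∀ c : ℕ, c ≤ 1 →
      Tendsto (fun n : ℕ => (((n + c) / 2 : ℕ) : ℝ) / n) atTop (𝓝 (1 / 2)) := by
    intro c hc
    have hlim : Tendsto (fun n : ℕ => (1 : ℝ) / n) atTop (𝓝 0) := tendsto_one_div_atTop_nhds_zero_nat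
    have h1 : Tendsto (fun n : ℕ => 1 / 2 - (1 : ℝ) / n) atTop (𝓝 (1 / 2)) := by
      simpa using tendsto_const_nhds.sub hlim
    have h2 : Tendsto (fun n : ℕ => 1 / 2 + (1 : ℝ) / n) atTop (𝓝 (1 / 2)) := by
      simpa using tendsto_const_nhds.add hlim
    refine tendsto_of_tendsto_of_tendsto_of_le_of_le' h1 h2 ?_ ?_
    · filter_upwards [eventually_gt_atTop 0] with n hn
      have hn' : (0 : ℝ) < n := by exact_mod_cast hn
      have : (n : ℝ) ≤ 2 * ((n + c) / 2 : ℕ) + 1 := by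
        exact_mod_cast (by omega : n ≤ 2 * ((n + c) / 2) + 1)
      rw [le_div_iff₀ hn', sub_mul, one_div_mul_cancel hn'.ne']
      linarith
    · filter_upwards [eventually_gt_atTop 0] with n hn
      have hn' : (0 : ℝ) < n := by exact_mod_cast hn
      have : 2 * (((n + c) / 2 : ℕ) : ℝ) ≤ n + 1 := by
        exact_mod_cast (by omega : 2 * ((n + c) / 2) ≤ n + 1)
      rw [div_le_iff₀ hn', add_mul, one_div_mul_cancel hn'.ne']
      linarith
  have hdiv : ∀ c : ℕ, Tendsto (fun n : ℕ => (n + c) / 2) atTop atTop := fun c =>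
    tendsto_atTop_atTop.2 fun b => ⟨2 * b, fun n hn => by omega⟩
  have key := ((he.comp (hdiv 1)).mul (hhalf 1 le_rfl)).add
    ((ho.comp (hdiv 0)).mul (hhalf 0 zero_le_one))
  rw [show m * (1 / 2) + m * (1 / 2) = m by ring] at key
  -- For small `n` a parity class may be empty; then `a = 0`, and the identity survives because the
  -- sum vanishes too.
  have hcancel : ∀ (s : ℝ) (a : ℕ) (n : ℝ), (a = 0 → s = 0) → s / a * (a / n) = s / n := by
    intro s a n h
    rcases eq_or_ne a 0 with rfl | ha
    · simp [h rfl]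
    · rw [div_mul_div_cancel₀ (Nat.cast_ne_zero.2 ha)]
  refine key.congr fun n => ?_
  simp only [Function.comp_apply, add_zero]
  rw [hcancel _ _ _ (by intro h; simp [h]), hcancel _ _ _ (by intro h; simp [h]), hsum, add_div]

/-- The strong law of large numbers for identically distributed variables that are independent as
soon as their indices differ by at least two. -/
theorem strong_law_ae_real_of_indepFun_add_two {Ω : Type*} [MeasurableSpace Ω] {μ : Measure Ω}
    (Y : ℕ → Ω → ℝ) (hint : Integrable (Y 0) μ)
    (hindep : ∀ i j, i + 2 ≤ j → IndepFun (Y i) (Y j) μ)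
    (hident : ∀ i, IdentDistrib (Y i) (Y 0) μ μ) :
    ∀ᵐ ω ∂μ, Tendsto (fun n : ℕ => (∑ i ∈ Finset.range n, Y i ω) / n) atTop (𝓝 (∫ ω, Y 0 ω ∂μ)) := by
  have key : ∀ c, ∀ᵐ ω ∂μ, Tendsto (fun n : ℕ => (∑ i ∈ Finset.range n, Y (2 * i + c) ω) / n) atTop
      (𝓝 (∫ ω, Y 0 ω ∂μ)) := by
    intro c
    -- Pairwise independence suffices here, and distinct indices of equal parity differ by at least
    -- two.
    have h := strong_law_ae_real (fun i => Y (2 * i + c)) ((hident _).integrable_iff.2 hint) ?_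
      fun i => (hident _).trans (hident _).symm
    · rwa [(hident _).integral_eq] at h
    · intro i j hij
      rcases lt_or_gt_of_ne hij with h | h
      · exact hindep _ _ (by omega)
      · exact (hindep _ _ (by omega)).symm
  filter_upwards [key 0, key 1] with ω h0 h1
  exact tendsto_average_of_even_odd (by simpa using h0) h1

/-! ### Wald's identity and integrability of the idle time -/

namespace GIGI11System

noncomputable section

variable {Ω : Type*} [MeasurableSpace Ω] {μ : Measure Ω} {S : GIGI11System μ}

theorem Regular.strong_law_cycle [IsProbabilityMeasure μ] (h : S.Regular) {γ : ℝ × ℝ × ℝ → ℝ}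
    (hγ : Measurable γ) (hint : Integrable (fun ω => γ (S.cycle 0 ω)) μ) :
    ∀ᵐ ω ∂μ, Tendsto (fun n : ℕ => (∑ i ∈ Finset.range n, γ (S.cycle i ω)) / n) atTop
      (𝓝 (∫ ω, γ (S.cycle 0 ω) ∂μ)) :=
  strong_law_ae_real_of_indepFun_add_two (fun i ω => γ (S.cycle i ω)) hint
    (fun _ _ hij => (h.indepFun_cycle hij).comp hγ hγ)
    fun i => (h.identDistrib_cycle i).comp hγ

/-- Wald's identity for the number of arrivals in the first service cycle. -/
theorem Regular.lintegral_sum_range_streamIndex_one [IsProbabilityMeasure μ] (h : S.Regular)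
    {f : ℝ → ENNReal} (hf : Measurable f) :
    ∫⁻ ω, ∑ i ∈ Finset.range (S.streamIndex 1 ω), f (S.Z i ω) ∂μ =
      (∫⁻ ω, f (S.Z 0 ω) ∂μ) * ∑' i, μ {ω | i < S.streamIndex 1 ω} := by
  -- Whether the cycle extends beyond arrival `i` is decided by `X 0` and the first `i`
  -- inter-arrival times, hence independently of `Z i`.
  have hpast : ∀ i, MeasurableSet[S.past 1 i] {ω | i < S.streamIndex 1 ω} := by
    intro i
    have : {ω | i < S.streamIndex 1 ω} = (⋃ n ∈ Set.Iic i, {ω | S.streamIndex 1 ω = n})ᶜ := by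
      ext ω
      simp only [Set.mem_ofPred_eq, Set.mem_compl_iff, Set.mem_iUnion, Set.mem_Iic, exists_prop,
        exists_eq_right', not_le]
    rw [this]
    exact (MeasurableSet.biUnion (Set.to_countable _) fun n hn =>
      past_mono le_rfl hn _ (h.measurableSet_streamIndex_eq 1 n)).compl
  have hsum : ∀ ω, ∑ i ∈ Finset.range (S.streamIndex 1 ω), f (S.Z i ω) =
      ∑' i, {ω | i < S.streamIndex 1 ω}.indicator 1 ω * f (S.Z i ω) := by
    intro ω
    rw [tsum_eq_sum (s := Finset.range (S.streamIndex 1 ω))]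
    · refine Finset.sum_congr rfl fun i hi => ?_
      rw [Set.indicator_of_mem (by simpa using hi)]
      simp
    · intro i hi
      rw [Set.indicator_of_notMem (by simpa using hi), zero_mul]
  have hind' : ∀ i, Measurable[S.past 1 i] ({ω | i < S.streamIndex 1 ω}.indicator (1 : Ω → ENNReal)) :=
    fun i => Measurable.indicator (m := S.past 1 i) (@measurable_const _ _ _ (S.past 1 i) 1) (hpast i)
  simp_rw [hsum]
  have hind := fun i => (hind' i).mono (past_le _ _) le_rfl
  have hZm := S.measurable_Z
  rw [lintegral_tsum fun i => Measurable.aemeasurable (by fun_prop), ← ENNReal.tsum_mul_left]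
  refine tsum_congr fun i => ?_
  rw [lintegral_mul_eq_lintegral_mul_lintegral_of_independent_measurableSpace (past_le 1 i)
    (measurable_future 1 i).comap_le (indep_past_future 1 i)
    (hind' i)]
  · rw [lintegral_indicator_one (past_le _ _ _ (hpast i)), mul_comm]
    congr 1
    exact ((S.identDistrib_Z i).comp hf).lintegral_eq
  · have : (fun ω => f (S.Z i ω)) = (fun w : ℕ ⊕ ℕ → ℝ => f (w (Sum.inr 0))) ∘ S.future 1 i := by
      ext ω
      simp [future]
    rw [this]
    exact (hf.comp (measurable_pi_apply _)).comp (comap_measurable _)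

/-- All arrivals of the cycle but the last come before the end of the service, so their
inter-arrival times sum to at most `X 0`; truncation bounds the last one by `1`. -/
theorem RegularAt.sum_min_le {ω : Ω} (h : S.RegularAt ω) :
    ∑ i ∈ Finset.range (S.streamIndex 1 ω), min (S.Z i ω) 1 ≤ S.X 0 ω + 1 := by
  have hs := (h.streamIndex_succ_eq_iff 0 _).1 rfl
  have h0 : S.streamIndex 0 ω = 0 := rfl
  rw [h0] at hs
  obtain ⟨m, hm⟩ := Nat.exists_eq_add_of_lt hs.1.1
  simp only [zero_add] at hm hs
  rw [hm, Finset.sum_range_succ]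
  have h1 : ∑ i ∈ Finset.range m, min (S.Z i ω) 1 ≤ S.renewal m ω :=
    Finset.sum_le_sum fun i _ => min_le_left _ _
  have h2 : S.renewal m ω ≤ S.X 0 ω := by
    -- Arrival `0` is never a candidate for the next packet, so minimality says nothing at `m = 0`.
    rcases Nat.eq_zero_or_pos m with rfl | hpos
    · simpa [renewal] using h.X_nonneg 0
    · have := hs.2 m (by omega)
      simp only [hpos, true_and, not_le] at this
      simpa [renewal] using this.le
  linarith [min_le_right (S.Z m ω) 1]

theorem Regular.integrable_idleTime_one [IsProbabilityMeasure μ] (h : S.Regular)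
    (hZ : Integrable (S.Z 0) μ) (hZpos : 0 < ∫ ω, S.Z 0 ω ∂μ) (hX : Integrable (S.X 0) μ) :
    Integrable (S.idleTime 1) μ := by
  -- The series is the mean number of arrivals in a cycle. Its product with `E[min Z 1]`, which is
  -- positive since `E[Z] > 0`, is at most `E[X] + 1`.
  have htau : ∑' i, μ {ω | i < S.streamIndex 1 ω} ≠ ⊤ := by
    have hW := h.lintegral_sum_range_streamIndex_one (f := fun z => ENNReal.ofReal (min z 1))
      (by fun_prop)
    have hle : ∫⁻ ω, ∑ i ∈ Finset.range (S.streamIndex 1 ω), ENNReal.ofReal (min (S.Z i ω) 1) ∂μ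
        ≤ ∫⁻ ω, ENNReal.ofReal (S.X 0 ω + 1) ∂μ := by
      refine lintegral_mono fun ω => ?_
      rw [← ENNReal.ofReal_sum_of_nonneg fun i _ => le_min ((h ω).Z_nonneg i) zero_le_one]
      exact ENNReal.ofReal_le_ofReal (h ω).sum_min_le
    have hfin : ∫⁻ ω, ENNReal.ofReal (S.X 0 ω + 1) ∂μ < ⊤ :=
      (hX.add (integrable_const 1)).lintegral_lt_top
    have hne : ∫⁻ ω, ENNReal.ofReal (min (S.Z 0 ω) 1) ∂μ ≠ 0 := by
      intro h0
      rw [lintegral_eq_zero_iff ((S.measurable_Z 0).min measurable_const).ennreal_ofReal] at h0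
      refine hZpos.ne' (integral_eq_zero_of_ae ?_)
      filter_upwards [h0] with ω hω
      have h1 := ENNReal.ofReal_eq_zero.1 hω
      rcases min_le_iff.1 h1 with h2 | h2
      · exact le_antisymm h2 ((h ω).Z_nonneg 0)
      · linarith
    intro htop
    rw [hW, htop, ENNReal.mul_top hne] at hle
    exact absurd (hle.trans_lt hfin) (lt_irrefl _)
  have hmeas : Measurable (S.idleTime 1) := (h.measurable_cycle 0).snd.snd
  refine (lintegral_ofReal_ne_top_iff_integrable hmeas.aestronglyMeasurable
    (ae_of_all _ fun ω => (h ω).idleTime_succ_nonneg 0)).1 (ne_of_lt ?_)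
  calc ∫⁻ ω, ENNReal.ofReal (S.idleTime 1 ω) ∂μ
      ≤ ∫⁻ ω, ∑ i ∈ Finset.range (S.streamIndex 1 ω), ENNReal.ofReal (S.Z i ω) ∂μ := by
        refine lintegral_mono fun ω => ?_
        rw [← ENNReal.ofReal_sum_of_nonneg fun i _ => (h ω).Z_nonneg i]
        refine ENNReal.ofReal_le_ofReal ?_
        rw [S.idleTime_succ 0 ω]
        have h0 : S.renewal (S.streamIndex 0 ω) ω = 0 := by simp [streamIndex, renewal]
        rw [h0, renewal]
        linarith [(h ω).X_nonneg 0]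
    _ = (∫⁻ ω, ENNReal.ofReal (S.Z 0 ω) ∂μ) * ∑' i, μ {ω | i < S.streamIndex 1 ω} :=
        h.lintegral_sum_range_streamIndex_one ENNReal.measurable_ofReal
    _ < ⊤ := ENNReal.mul_lt_top hZ.lintegral_lt_top htau.lt_top

end

end GIGI11System

/-! ### Deterministic renewal-reward -/

theorem tendsto_succ_div_nat {u : ℕ → ℝ} {l : ℝ}
    (h : Tendsto (fun n : ℕ => u n / n) atTop (𝓝 l)) :
    Tendsto (fun n : ℕ => u (n + 1) / n) atTop (𝓝 l) := by
  have h1 : Tendsto (fun n : ℕ => ((n + 1 : ℕ) : ℝ) / n) atTop (𝓝 1) := by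
    have : Tendsto (fun n : ℕ => 1 + (1 : ℝ) / n) atTop (𝓝 (1 + 0)) :=
      tendsto_const_nhds.add tendsto_one_div_atTop_nhds_zero_nat
    rw [add_zero] at this
    refine this.congr' ?_
    filter_upwards [eventually_gt_atTop 0] with n hn
    have hn' : (n : ℝ) ≠ 0 := by exact_mod_cast hn.ne'
    push_cast
    field_simp
  have h2 := (h.comp (tendsto_add_atTop_nat 1)).mul h1
  rw [mul_one] at h2
  refine h2.congr fun n => ?_
  exact div_mul_div_cancel₀ (Nat.cast_ne_zero.2 n.succ_ne_zero)

/-- The renewal-reward argument: a function that between the successive epochs `D n` differs by a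
bounded amount from the cumulated reward `G n` grows at the rate of the mean reward per mean
distance of epochs. -/
theorem tendsto_div_of_renewal_reward {D G : ℕ → ℝ} {F : ℝ → ℝ} {c γ C : ℝ} (hD : Monotone D)
    (hc : 0 < c) (hDlim : Tendsto (fun n : ℕ => D n / n) atTop (𝓝 c))
    (hGlim : Tendsto (fun n : ℕ => G n / n) atTop (𝓝 γ))
    (hF : ∀ n T, D n ≤ T → T < D (n + 1) → G n - C ≤ F T ∧ F T ≤ G (n + 1) + C) :
    Tendsto (fun T => F T / T) atTop (𝓝 (γ / c)) := by
  have hDtop : Tendsto D atTop atTop := by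
    have h := hDlim.pos_mul_atTop hc tendsto_natCast_atTop_atTop
    refine h.congr' ?_
    filter_upwards [eventually_gt_atTop 0] with n hn
    exact div_mul_cancel₀ _ (by exact_mod_cast hn.ne')
  -- `N T` will be the number of the epoch interval containing `T`; the guard `D 0 ≤ T` makes the
  -- choice possible for every `T`.
  have hex : ∀ T, ∃ n, D 0 ≤ T → D n ≤ T ∧ T < D (n + 1) := by
    intro T
    by_cases hT : D 0 ≤ T
    · have hfind : ∃ n, T < D n := (hDtop.eventually_gt_atTop T).exists
      classical
      have hpos : Nat.find hfind ≠ 0 := fun h0 => by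
        have := Nat.find_spec hfind
        rw [h0] at this
        exact this.not_ge hT
      obtain ⟨m, hm⟩ := Nat.exists_eq_succ_of_ne_zero hpos
      refine ⟨m, fun _ => ⟨not_lt.1 (Nat.find_min hfind (by omega)), ?_⟩⟩
      have := Nat.find_spec hfind
      rwa [hm] at this
    · exact ⟨0, fun h => absurd h hT⟩
  choose N hN using hex
  have hNtop : Tendsto N atTop atTop := by
    refine tendsto_atTop.2 fun b => ?_
    filter_upwards [eventually_ge_atTop (D b), eventually_ge_atTop (D 0)] with T hb h0
    by_contra! hlt
    exact ((hN T h0).2.trans_le (hD hlt)).not_ge hb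
  have hC : Tendsto (fun n : ℕ => C / (n : ℝ)) atTop (𝓝 0) := tendsto_const_div_atTop_nhds_zero_nat C
  have hT : Tendsto (fun T => T / N T) atTop (𝓝 c) := by
    refine tendsto_of_tendsto_of_tendsto_of_le_of_le' (hDlim.comp hNtop)
      ((tendsto_succ_div_nat hDlim).comp hNtop) ?_ ?_
    · filter_upwards [eventually_ge_atTop (D 0)] with T h0
      exact div_le_div_of_nonneg_right (hN T h0).1 (Nat.cast_nonneg _)
    · filter_upwards [eventually_ge_atTop (D 0)] with T h0
      exact div_le_div_of_nonneg_right (hN T h0).2.le (Nat.cast_nonneg _)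
  have hFN : Tendsto (fun T => F T / N T) atTop (𝓝 γ) := by
    have hl := (hGlim.sub hC).comp hNtop
    have hu := ((tendsto_succ_div_nat hGlim).add hC).comp hNtop
    rw [sub_zero] at hl
    rw [add_zero] at hu
    refine tendsto_of_tendsto_of_tendsto_of_le_of_le' hl hu ?_ ?_
    · filter_upwards [eventually_ge_atTop (D 0)] with T h0
      simp only [Function.comp_apply]
      rw [← sub_div]
      exact div_le_div_of_nonneg_right (hF _ T (hN T h0).1 (hN T h0).2).1 (Nat.cast_nonneg _)
    · filter_upwards [eventually_ge_atTop (D 0)] with T h0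
      simp only [Function.comp_apply]
      rw [← add_div]
      exact div_le_div_of_nonneg_right (hF _ T (hN T h0).1 (hN T h0).2).2 (Nat.cast_nonneg _)
  refine (hFN.div hT hc.ne').congr' ?_
  filter_upwards [hNtop.eventually_gt_atTop 0] with T hpos
  exact div_div_div_cancel_right₀ (by exact_mod_cast hpos.ne') _ _

/-- The source of the shape of `g`: `a` and `b` will be successive departures and `c` the instant at
which the current packet reaches age `d`. -/
theorem volume_real_Ico_inter_Ioi {a b : ℝ} (hab : a ≤ b) (c : ℝ) :
    volume.real (Set.Ico a b ∩ Set.Ioi c) = min (max 0 (b - c)) (b - a) := by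
  rcases le_or_gt a c with h | h
  · have : Set.Ico a b ∩ Set.Ioi c = Set.Ioo c b := by
      ext t
      simp only [Set.mem_inter_iff, Set.mem_Ico, Set.mem_Ioi, Set.mem_Ioo]
      exact ⟨fun h => ⟨h.2, h.1.2⟩, fun h' => ⟨⟨h.trans h'.1.le, h'.2⟩, h'.1⟩⟩
    rw [this, Measure.real, Real.volume_Ioo, ENNReal.toReal_ofReal', max_comm, min_eq_left]
    exact max_le (by linarith) (by linarith)
  · have : Set.Ico a b ∩ Set.Ioi c = Set.Ico a b :=
      Set.inter_eq_left.2 fun t ht => h.trans_le ht.1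
    rw [this, Measure.real, Real.volume_Ico, ENNReal.toReal_ofReal (by linarith), min_eq_right]
    exact le_max_of_le_right (by linarith)

/-! ### Violation time along a sample path -/

namespace GIGI11System

noncomputable section

variable {Ω : Type*} [MeasurableSpace Ω] {μ : Measure Ω} {S : GIGI11System μ} {ω : Ω}

theorem departureTime_succ (n : ℕ) (ω : Ω) : S.departureTime (n + 1) ω =
    S.departureTime n ω + (S.X (n + 1) ω + S.idleTime (n + 1) ω) := by
  simp only [idleTime, departureTime, Nat.add_sub_cancel]
  ring

theorem departureTime_eq_sum (n : ℕ) (ω : Ω) : S.departureTime n ω = S.departureTime 0 ω +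
    ∑ i ∈ Finset.range n, (S.X (i + 1) ω + S.idleTime (i + 1) ω) := by
  induction n with
  | zero => simp
  | succ n ih => rw [departureTime_succ, ih, Finset.sum_range_succ, add_assoc]

theorem RegularAt.monotone_departureTime (h : S.RegularAt ω) :
    Monotone fun n => S.departureTime n ω :=
  monotone_nat_of_le_succ fun n => by
    rw [departureTime_succ]
    linarith [h.X_nonneg (n + 1), h.idleTime_succ_nonneg n]

theorem RegularAt.monotone_arrivalTime (h : S.RegularAt ω) :
    Monotone fun n => S.arrivalTime n ω := fun m n hmn => by
  simp only [arrivalTime, streamArrival_eq]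
  linarith [h.renewal_mono (h.strictMono_streamIndex.monotone hmn)]

/-- Served packets depart in the order of arrival, so packet `n` is the freshest one delivered; all
packets of the past arrived before packet `0`. -/
theorem RegularAt.age_eq (h : S.RegularAt ω) (hpast : ∀ j, S.pastArrival j ω ≤ S.firstArrival ω)
    {n : ℕ} {t : ℝ} (h1 : S.departureTime n ω ≤ t) (h2 : t < S.departureTime (n + 1) ω) :
    S.age t ω = t - S.arrivalTime n ω := by
  rw [age, IsGreatest.csSup_eq (a := S.arrivalTime n ω)]
  refine ⟨Or.inl ⟨n, h1, rfl⟩, ?_⟩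
  rintro s (⟨m, hm, rfl⟩ | ⟨j, -, rfl⟩)
  · refine h.monotone_arrivalTime (Nat.lt_succ_iff.1 ?_)
    by_contra! hle
    exact (h2.trans_le (h.monotone_departureTime hle)).not_ge hm
  · refine (hpast j).trans ?_
    have : S.firstArrival ω = S.arrivalTime 0 ω := by
      simp [arrivalTime, streamIndex, streamArrival]
    rw [this]
    exact h.monotone_arrivalTime n.zero_le

variable (S) in
/-- The times between the departures of packets `n` and `n + 1` at which packet `n` is older than
`d`. -/
def violationPiece (d : ℝ) (n : ℕ) (ω : Ω) : Set ℝ :=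
  Set.Ico (S.departureTime n ω) (S.departureTime (n + 1) ω) ∩ Set.Ioi (d + S.arrivalTime n ω)

variable (S) in
/-- The times after the departure of packet `0` at which the most recent of the delivered packets
is older than `d`. -/
def violationSet (d : ℝ) (ω : Ω) : Set ℝ := ⋃ n, S.violationPiece d n ω

theorem RegularAt.volume_real_violationPiece (h : S.RegularAt ω) (d : ℝ) (n : ℕ) :
    volume.real (S.violationPiece d n ω) = S.g d (n + 1) ω := by
  have hle : S.departureTime n ω ≤ S.departureTime (n + 1) ω := h.monotone_departureTime n.le_succ
  rw [violationPiece, volume_real_Ico_inter_Ioi hle, g]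
  congr 2
  · rw [departureTime_succ, departureTime, Nat.add_sub_cancel]
    ring
  · rw [departureTime_succ]
    ring

theorem RegularAt.volume_real_biUnion_violationPiece (h : S.RegularAt ω) (d : ℝ) (n : ℕ) :
    volume.real (⋃ i ∈ Finset.range n, S.violationPiece d i ω) =
      ∑ i ∈ Finset.range n, S.g d (i + 1) ω := by
  have hfin : ∀ i ∈ Finset.range n, volume (S.violationPiece d i ω) ≠ ⊤ := fun i _ =>
    measure_ne_top_of_subset Set.inter_subset_left (by simp)
  rw [measureReal_biUnion_finset (h := hfin)]
  · exact Finset.sum_congr rfl fun i _ => h.volume_real_violationPiece d i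
  · intro i _ j _ hij
    exact (h.monotone_departureTime.pairwise_disjoint_on_Ico_succ hij).mono
      Set.inter_subset_left Set.inter_subset_left
  · exact fun i _ => measurableSet_Ico.inter measurableSet_Ioi

theorem RegularAt.lt_age_iff (h : S.RegularAt ω)
    (hpast : ∀ j, S.pastArrival j ω ≤ S.firstArrival ω)
    (hD : Tendsto (fun n => S.departureTime n ω) atTop atTop) (d : ℝ) {t : ℝ}
    (ht : S.departureTime 0 ω ≤ t) : d < S.age t ω ↔ t ∈ S.violationSet d ω := by
  obtain ⟨n, h1, h2⟩ : ∃ n, S.departureTime n ω ≤ t ∧ t < S.departureTime (n + 1) ω := by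
    by_contra! hcon
    obtain ⟨m, hm⟩ := (hD.eventually_gt_atTop t).exists
    have : ∀ m, S.departureTime m ω ≤ t := fun m => by
      induction m with
      | zero => exact ht
      | succ m ih => exact hcon m ih
    exact hm.not_ge (this m)
  simp only [violationSet, violationPiece, Set.mem_iUnion, Set.mem_inter_iff, Set.mem_Ico,
    Set.mem_Ioi]
  constructor
  · intro hlt
    rw [h.age_eq hpast h1 h2] at hlt
    exact ⟨n, ⟨h1, h2⟩, by linarith⟩
  · rintro ⟨m, ⟨h1', h2'⟩, h3⟩
    rw [h.age_eq hpast h1' h2']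
    linarith

/-- `E` is prescribed only after the first departure and need not be measurable: this covers both
the times with `d < age` and the set `violationSet`. -/
theorem RegularAt.tendsto_volume_real_div (h : S.RegularAt ω) (d : ℝ) {c γ : ℝ} (hc : 0 < c)
    (hsum : Tendsto (fun n : ℕ => (∑ i ∈ Finset.range n,
      (S.X (i + 1) ω + S.idleTime (i + 1) ω)) / n) atTop (𝓝 c))
    (hg : Tendsto (fun n : ℕ => (∑ i ∈ Finset.range n, S.g d (i + 1) ω) / n) atTop (𝓝 γ))
    {E : Set ℝ} (hE : ∀ t, S.departureTime 0 ω ≤ t → (t ∈ E ↔ t ∈ S.violationSet d ω)) :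
    Tendsto (fun T : ℝ => volume.real {t : ℝ | t ∈ Set.Icc 0 T ∧ t ∈ E} / T) atTop
      (𝓝 (γ / c)) := by
  -- `K` contains everything between time `0` and the first departure, whatever the sign of the
  -- latter, and so bounds the error at the start.
  set K := Set.Icc (-|S.departureTime 0 ω|) |S.departureTime 0 ω| with hK
  have hDlim : Tendsto (fun n : ℕ => S.departureTime n ω / n) atTop (𝓝 c) := by
    have h0 : Tendsto (fun n : ℕ => S.departureTime 0 ω / (n : ℝ)) atTop (𝓝 0) :=
      tendsto_const_div_atTop_nhds_zero_nat _
    have := h0.add hsum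
    rw [zero_add] at this
    refine this.congr fun n => ?_
    rw [S.departureTime_eq_sum n, add_div]
  refine tendsto_div_of_renewal_reward (C := volume.real K) h.monotone_departureTime hc hDlim hg ?_
  intro n T h1 h2
  have hKtop : volume K ≠ ⊤ := by simp [hK]
  have hbi : ∀ n, volume (⋃ i ∈ Finset.range n, S.violationPiece d i ω) ≠ ⊤ := fun n =>
    ((measure_biUnion_lt_top (Finset.finite_toSet _) fun i _ =>
      measure_lt_top_of_subset Set.inter_subset_left (by simp))).ne
  have hFtop : volume {t : ℝ | t ∈ Set.Icc 0 T ∧ t ∈ E} ≠ ⊤ :=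
    by
    have hsub : {t : ℝ | t ∈ Set.Icc 0 T ∧ t ∈ E} ⊆ Set.Icc 0 T := fun t ht => ht.1
    exact measure_ne_top_of_subset hsub measure_Icc_lt_top.ne
  rw [← h.volume_real_biUnion_violationPiece, ← h.volume_real_biUnion_violationPiece]
  have habs := neg_abs_le (S.departureTime 0 ω)
  have habs' := le_abs_self (S.departureTime 0 ω)
  constructor
  · rw [sub_le_iff_le_add]
    refine (measureReal_mono ?_ (measure_union_ne_top hFtop hKtop)).trans (measureReal_union_le _ _)
    intro t ht
    simp only [Set.mem_iUnion, Finset.mem_range] at ht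
    obtain ⟨i, hi, ht⟩ := ht
    have h0 : S.departureTime 0 ω ≤ t := (h.monotone_departureTime i.zero_le).trans ht.1.1
    rcases lt_or_ge t 0 with hneg | hpos
    · exact Or.inr ⟨habs.trans h0, hneg.le.trans (abs_nonneg _)⟩
    · refine Or.inl ⟨⟨hpos, ?_⟩, (hE t h0).2 (Set.mem_iUnion.2 ⟨i, ht⟩)⟩
      exact (ht.1.2.le.trans (h.monotone_departureTime hi)).trans h1
  · refine (measureReal_mono ?_ (measure_union_ne_top (hbi _) hKtop)).trans
      (measureReal_union_le _ _)
    rintro t ⟨ht, htE⟩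
    rcases lt_or_ge t (S.departureTime 0 ω) with hlt | h0
    · exact Or.inr ⟨by linarith [abs_nonneg (S.departureTime 0 ω), ht.1], hlt.le.trans habs'⟩
    · obtain ⟨i, hi⟩ := Set.mem_iUnion.1 ((hE t h0).1 htE)
      refine Or.inl ?_
      simp only [Set.mem_iUnion, Finset.mem_range]
      refine ⟨i, ?_, hi⟩
      by_contra! hle
      exact (h2.trans_le (h.monotone_departureTime hle)).not_ge (hi.1.1.trans ht.2)

end

end GIGI11System

/-! ### Time averages and limiting probabilities -/

/-- If the probabilities of the time sections of a measurable set converge and its fractions of time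
converge almost surely to a constant, then the limits are equal. -/
theorem eq_of_tendsto_measureReal_of_tendsto_time_average {Ω : Type*} [MeasurableSpace Ω]
    {μ : Measure Ω} [IsProbabilityMeasure μ] {V : Set (ℝ × Ω)} (hV : MeasurableSet V) {p L : ℝ}
    (hp : Tendsto (fun t : ℝ => μ.real (Prod.mk t ⁻¹' V)) atTop (𝓝 p))
    (hL : ∀ᵐ ω ∂μ, Tendsto (fun T : ℝ => volume.real {t : ℝ | t ∈ Set.Icc 0 T ∧ (t, ω) ∈ V} / T)
      atTop (𝓝 L)) : p = L := by
  have hsec : ∀ T ω, {t : ℝ | t ∈ Set.Icc 0 T ∧ (t, ω) ∈ V} = (fun t => (t, ω)) ⁻¹' V ∩ Set.Icc 0 T :=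
    fun T ω => Set.inter_comm _ _
  have hsecm : ∀ ω, MeasurableSet ((fun t : ℝ => (t, ω)) ⁻¹' V) := fun ω =>
    measurable_prodMk_right hV
  have hq : Measurable fun t : ℝ => μ (Prod.mk t ⁻¹' V) := measurable_measure_prodMk_left hV
  have hr : ∀ T : ℝ, Measurable fun ω => volume {t : ℝ | t ∈ Set.Icc 0 T ∧ (t, ω) ∈ V} := by
    intro T
    have := measurable_measure_prodMk_right (μ := volume.restrict (Set.Icc 0 T)) hV
    simpa only [hsec, Measure.restrict_apply (hsecm _)] using this
  have hfubini : ∀ T : ℝ, ∫ ω, volume.real {t : ℝ | t ∈ Set.Icc 0 T ∧ (t, ω) ∈ V} ∂μ =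
      ∫ t in Set.Icc 0 T, μ.real (Prod.mk t ⁻¹' V) := by
    intro T
    simp only [Measure.real]
    rw [integral_toReal (hr T).aemeasurable, integral_toReal hq.aemeasurable
      (ae_of_all _ fun _ => measure_lt_top _ _), ← Measure.prod_apply hV,
      Measure.prod_apply_symm hV]
    · simp only [hsec, Measure.restrict_apply (hsecm _)]
    · refine ae_of_all _ fun ω => ?_
      rw [hsec]
      exact (measure_mono Set.inter_subset_right).trans_lt measure_Icc_lt_top
  have h1 : Tendsto (fun T : ℝ => ∫ ω, volume.real {t : ℝ | t ∈ Set.Icc 0 T ∧ (t, ω) ∈ V} / T ∂μ)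
      atTop (𝓝 L) := by
    have := tendsto_integral_filter_of_dominated_convergence (μ := μ) (l := atTop)
      (F := fun (T : ℝ) ω => volume.real {t : ℝ | t ∈ Set.Icc 0 T ∧ (t, ω) ∈ V} / T)
      (f := fun _ => L) (fun _ => 1)
      (Eventually.of_forall fun T => ((hr T).ennreal_toReal.div_const T).aestronglyMeasurable)
      ?_ (integrable_const _) hL
    · simpa using this
    · filter_upwards [eventually_gt_atTop 0] with T hT
      refine ae_of_all _ fun ω => ?_
      rw [Real.norm_of_nonneg (by positivity), div_le_one hT, hsec]
      refine (measureReal_mono Set.inter_subset_right measure_Icc_lt_top.ne).trans ?_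
      simp [hT.le]
  -- The time average over `[0, T]`, rescaled by `t = T * s`: for fixed `s > 0` the integrand
  -- converges to `p`, and it is bounded by `1`.
  have h2 : Tendsto (fun T : ℝ => ∫ s in (0 : ℝ)..1, μ.real (Prod.mk (T * s) ⁻¹' V)) atTop
      (𝓝 p) := by
    have := intervalIntegral.tendsto_integral_filter_of_dominated_convergence (μ := volume)
      (a := 0) (b := 1) (l := atTop) (F := fun (T : ℝ) s => μ.real (Prod.mk (T * s) ⁻¹' V))
      (f := fun _ => p) (fun _ => 1)
      (Eventually.of_forall fun T => ((hq.comp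
        (measurable_const_mul T)).ennreal_toReal).aestronglyMeasurable)
      (Eventually.of_forall fun T => ae_of_all _ fun s _ => by
        rw [Real.norm_of_nonneg measureReal_nonneg]
        exact measureReal_le_one) intervalIntegrable_const
      (ae_of_all _ fun s hs => ?_)
    · simpa using this
    · rw [Set.uIoc_of_le zero_le_one] at hs
      exact hp.comp (tendsto_id.atTop_mul_const hs.1)
  refine tendsto_nhds_unique h2 (h1.congr' ?_)
  filter_upwards [eventually_gt_atTop 0] with T hT
  rw [integral_div, hfubini, integral_Icc_eq_integral_Ioc, ← intervalIntegral.integral_of_le hT.le,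
    intervalIntegral.integral_comp_mul_left (fun t => μ.real (Prod.mk t ⁻¹' V)) hT.ne']
  simp [div_eq_inv_mul]

/-- Applied to the departure of packet `0`, this removes the initial condition from the limiting
probability. -/
theorem tendsto_measureReal_lt_atTop {Ω : Type*} [MeasurableSpace Ω] {μ : Measure Ω}
    [IsProbabilityMeasure μ] {D : Ω → ℝ} (hD : Measurable D) :
    Tendsto (fun t : ℝ => μ.real {ω | t < D ω}) atTop (𝓝 0) := by
  have h := tendsto_measure_iInter_atTop (μ := μ) (s := fun t : ℝ => {ω | t < D ω})
    (fun t => (measurableSet_lt measurable_const hD).nullMeasurableSet)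
    (fun s t hst ω (hω : t < D ω) => lt_of_le_of_lt hst hω) ⟨0, measure_ne_top _ _⟩
  have h0 : ⋂ t : ℝ, {ω | t < D ω} = ∅ :=
    Set.eq_empty_of_forall_notMem fun ω hω => lt_irrefl (D ω) (Set.mem_iInter.1 hω (D ω))
  rw [h0, measure_empty] at h
  exact (ENNReal.tendsto_toReal ENNReal.zero_ne_top).comp h

/-! ### The limits for an everywhere regular system -/

namespace GIGI11System

noncomputable section

variable {Ω : Type*} [MeasurableSpace Ω] {μ : Measure Ω} {S : GIGI11System μ}

theorem ae_pastArrival_le (S : GIGI11System μ) :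
    ∀ᵐ ω ∂μ, ∀ j, S.pastArrival j ω ≤ S.firstArrival ω := by
  filter_upwards [ae_all_iff.2 S.pastArrival_le, S.pastDeparture_zero_le,
    ae_all_iff.2 S.pastDeparture_succ_le] with ω h1 h2 h3 j
  induction j with
  | zero => exact (h1 0).trans h2
  | succ j ih => exact ((h1 (j + 1)).trans (h3 j)).trans ih

theorem Regular.measurable_arrivalTime (h : S.Regular) (k : ℕ) : Measurable (S.arrivalTime k) :=
  S.measurable_firstArrival.add
    (measurable_sum_range_comp S.measurable_Z (h.measurable_streamIndex k))

theorem Regular.measurable_departureTime (h : S.Regular) (k : ℕ) :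
    Measurable (S.departureTime k) :=
  (h.measurable_arrivalTime k).add (S.measurable_X k)

/-- Joint measurability is what Fubini requires. Passing through this set avoids any measurability
question about the supremum in `age`. -/
theorem Regular.measurableSet_violationSet (h : S.Regular) (d : ℝ) :
    MeasurableSet {p : ℝ × Ω | p.1 ∈ S.violationSet d p.2} := by
  have : {p : ℝ × Ω | p.1 ∈ S.violationSet d p.2} = ⋃ n,
      {p : ℝ × Ω | S.departureTime n p.2 ≤ p.1} ∩ {p : ℝ × Ω | p.1 < S.departureTime (n + 1) p.2} ∩
        {p : ℝ × Ω | d + S.arrivalTime n p.2 < p.1} := by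
    ext p
    simp [violationSet, violationPiece]
  rw [this]
  refine MeasurableSet.iUnion fun n => ((measurableSet_le ?_ measurable_fst).inter
    (measurableSet_lt measurable_fst ?_)).inter (measurableSet_lt ?_ measurable_fst)
  · exact (h.measurable_departureTime n).comp measurable_snd
  · exact (h.measurable_departureTime (n + 1)).comp measurable_snd
  · exact ((h.measurable_arrivalTime n).comp measurable_snd).const_add d

/-- The contribution of a service cycle to the time of violation, as a functional of the cycle. -/
def gOf (d : ℝ) (c : ℝ × ℝ × ℝ) : ℝ :=
  min (max 0 (c.1 + c.2.2 + c.2.1 - d)) (c.2.1 + c.2.2)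

theorem measurable_gOf (d : ℝ) : Measurable (gOf d) := by
  unfold gOf
  fun_prop

theorem Regular.identDistrib_g [IsProbabilityMeasure μ] (h : S.Regular) (d : ℝ) (k : ℕ) :
    IdentDistrib (S.g d (k + 1)) (S.g d 1) μ μ :=
  (h.identDistrib_cycle k).comp (measurable_gOf d)

theorem Regular.identDistrib_idleTime [IsProbabilityMeasure μ] (h : S.Regular) (k : ℕ) :
    IdentDistrib (S.idleTime (k + 1)) (S.idleTime 1) μ μ :=
  (h.identDistrib_cycle k).comp measurable_snd.snd

theorem Regular.integrable_g_one [IsProbabilityMeasure μ] (h : S.Regular) (d : ℝ)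
    (hX : Integrable (S.X 0) μ) (hI : Integrable (S.idleTime 1) μ) : Integrable (S.g d 1) μ := by
  refine (((S.identDistrib_X 1).integrable_iff.2 hX).add hI).mono'
    ((measurable_gOf d).comp (h.measurable_cycle 0)).aestronglyMeasurable (ae_of_all _ fun ω => ?_)
  have h0 : 0 ≤ S.g d 1 ω := le_min (le_max_left _ _)
    (add_nonneg ((h ω).X_nonneg 1) ((h ω).idleTime_succ_nonneg 0))
  rw [Real.norm_of_nonneg h0]
  exact min_le_right _ _

theorem Regular.departureRate_mul_integral_g [IsProbabilityMeasure μ] (h : S.Regular) (d : ℝ)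
    (k : ℕ) : S.departureRate (k + 1) * ∫ ω, S.g d (k + 1) ω ∂μ =
      (∫ ω, S.g d 1 ω ∂μ) / ((∫ ω, S.X 0 ω ∂μ) + ∫ ω, S.idleTime 1 ω ∂μ) := by
  rw [departureRate, (S.identDistrib_X _).integral_eq, (h.identDistrib_idleTime k).integral_eq,
    (h.identDistrib_g d k).integral_eq, one_div_mul_eq_div]

theorem Regular.ae_tendsto_sum_departureTime_sub [IsProbabilityMeasure μ] (h : S.Regular)
    (hX : Integrable (S.X 0) μ) (hI : Integrable (S.idleTime 1) μ) :
    ∀ᵐ ω ∂μ, Tendsto (fun n : ℕ => (∑ i ∈ Finset.range n,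
      (S.X (i + 1) ω + S.idleTime (i + 1) ω)) / n) atTop
      (𝓝 ((∫ ω, S.X 0 ω ∂μ) + ∫ ω, S.idleTime 1 ω ∂μ)) := by
  have hX1 := (S.identDistrib_X 1).integrable_iff.2 hX
  have := h.strong_law_cycle (γ := fun c => c.2.1 + c.2.2) (by fun_prop) (hX1.add hI)
  simp only [cycle, zero_add, integral_add hX1 hI, (S.identDistrib_X 1).integral_eq] at this
  exact this

theorem mean_cycle_pos (h : S.Regular) (hXpos : 0 < ∫ ω, S.X 0 ω ∂μ) :
    0 < (∫ ω, S.X 0 ω ∂μ) + ∫ ω, S.idleTime 1 ω ∂μ :=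
  add_pos_of_pos_of_nonneg hXpos (integral_nonneg fun ω => (h ω).idleTime_succ_nonneg 0)

/-- The exceptional null set does not depend on `E`, so `E` may be chosen depending on `ω`. -/
theorem Regular.ae_tendsto_volume_real_div [IsProbabilityMeasure μ] (h : S.Regular) (d : ℝ)
    (hX : Integrable (S.X 0) μ) (hXpos : 0 < ∫ ω, S.X 0 ω ∂μ) (hI : Integrable (S.idleTime 1) μ) :
    ∀ᵐ ω ∂μ, ∀ E : Set ℝ,
      (∀ t, S.departureTime 0 ω ≤ t → (t ∈ E ↔ t ∈ S.violationSet d ω)) →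
      Tendsto (fun T : ℝ => volume.real {t : ℝ | t ∈ Set.Icc 0 T ∧ t ∈ E} / T) atTop
        (𝓝 ((∫ ω, S.g d 1 ω ∂μ) / ((∫ ω, S.X 0 ω ∂μ) + ∫ ω, S.idleTime 1 ω ∂μ))) := by
  filter_upwards [h.ae_tendsto_sum_departureTime_sub hX hI,
    h.strong_law_cycle (measurable_gOf d) (h.integrable_g_one d hX hI)] with ω h1 h2 E hE
  exact (h ω).tendsto_volume_real_div d (mean_cycle_pos h hXpos) h1 h2 hE

theorem Regular.ae_lt_age_iff [IsProbabilityMeasure μ] (h : S.Regular) (d : ℝ)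
    (hX : Integrable (S.X 0) μ) (hXpos : 0 < ∫ ω, S.X 0 ω ∂μ) (hI : Integrable (S.idleTime 1) μ) :
    ∀ᵐ ω ∂μ, ∀ t, S.departureTime 0 ω ≤ t → (d < S.age t ω ↔ t ∈ S.violationSet d ω) := by
  filter_upwards [h.ae_tendsto_sum_departureTime_sub hX hI, S.ae_pastArrival_le] with ω h1 h2 t ht
  refine (h ω).lt_age_iff h2 ?_ d ht
  have h3 : Tendsto (fun n : ℕ => ∑ i ∈ Finset.range n,
      (S.X (i + 1) ω + S.idleTime (i + 1) ω)) atTop atTop := by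
    refine (h1.pos_mul_atTop (mean_cycle_pos h hXpos) tendsto_natCast_atTop_atTop).congr' ?_
    filter_upwards [eventually_gt_atTop 0] with n hn
    exact div_mul_cancel₀ _ (by exact_mod_cast hn.ne')
  exact (tendsto_atTop_add_const_left _ _ h3).congr fun n => (S.departureTime_eq_sum n ω).symm

theorem Regular.ae_tendsto_violation_time [IsProbabilityMeasure μ] (h : S.Regular) (d : ℝ)
    (hX : Integrable (S.X 0) μ) (hXpos : 0 < ∫ ω, S.X 0 ω ∂μ) (hI : Integrable (S.idleTime 1) μ) :
    ∀ᵐ ω ∂μ, Tendsto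
      (fun T : ℝ => volume.real {t : ℝ | t ∈ Set.Icc 0 T ∧ d < S.age t ω} / T) atTop
      (𝓝 ((∫ ω, S.g d 1 ω ∂μ) / ((∫ ω, S.X 0 ω ∂μ) + ∫ ω, S.idleTime 1 ω ∂μ))) := by
  filter_upwards [h.ae_tendsto_volume_real_div d hX hXpos hI, h.ae_lt_age_iff d hX hXpos hI]
    with ω h1 h2
  exact h1 {t | d < S.age t ω} h2

/-- Up to a null set, the two events can differ only if `t` precedes the departure of packet `0`,
which has vanishing probability. -/
theorem Regular.tendsto_measureReal_violationSet [IsProbabilityMeasure μ] (h : S.Regular)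
    {d p : ℝ} (hX : Integrable (S.X 0) μ) (hXpos : 0 < ∫ ω, S.X 0 ω ∂μ)
    (hI : Integrable (S.idleTime 1) μ) (hp : S.HasViolationProbability d p) :
    Tendsto (fun t : ℝ => μ.real {ω | t ∈ S.violationSet d ω}) atTop (𝓝 p) := by
  have hle : ∀ (A B C : Set Ω), (∀ᵐ ω ∂μ, ω ∈ A → ω ∈ B ∪ C) → μ.real A ≤ μ.real B + μ.real C :=
    fun A B C hABC => (ENNReal.toReal_mono (measure_ne_top _ _) (measure_mono_ae hABC)).trans
      (measureReal_union_le _ _)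
  have h0 := tendsto_measureReal_lt_atTop (μ := μ) (h.measurable_departureTime 0)
  have hl := Tendsto.sub hp h0
  have hu := Tendsto.add hp h0
  rw [sub_zero] at hl
  rw [add_zero] at hu
  refine tendsto_of_tendsto_of_tendsto_of_le_of_le hl hu (fun t => ?_) fun t => ?_
  · rw [sub_le_iff_le_add]
    refine hle _ _ _ ?_
    filter_upwards [h.ae_lt_age_iff d hX hXpos hI] with ω hω hA
    rcases lt_or_ge t (S.departureTime 0 ω) with ht | ht
    · exact Or.inr ht
    · exact Or.inl ((hω t ht).1 hA)
  · refine hle _ _ _ ?_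
    filter_upwards [h.ae_lt_age_iff d hX hXpos hI] with ω hω hA
    rcases lt_or_ge t (S.departureTime 0 ω) with ht | ht
    · exact Or.inr ht
    · exact Or.inl ((hω t ht).2 hA)

theorem Regular.eq_of_hasViolationProbability [IsProbabilityMeasure μ] (h : S.Regular)
    {d p : ℝ} (hX : Integrable (S.X 0) μ) (hXpos : 0 < ∫ ω, S.X 0 ω ∂μ)
    (hI : Integrable (S.idleTime 1) μ) (hp : S.HasViolationProbability d p) :
    p = (∫ ω, S.g d 1 ω ∂μ) / ((∫ ω, S.X 0 ω ∂μ) + ∫ ω, S.idleTime 1 ω ∂μ) := by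
  refine eq_of_tendsto_measureReal_of_tendsto_time_average (h.measurableSet_violationSet d)
    (h.tendsto_measureReal_violationSet hX hXpos hI hp) ?_
  filter_upwards [h.ae_tendsto_volume_real_div d hX hXpos hI] with ω hω
  exact hω (S.violationSet d ω) fun _ _ => Iff.rfl

/-! ### Reduction to an everywhere regular system -/

theorem ae_regularAt [IsProbabilityMeasure μ] (S : GIGI11System μ) (hZ : Integrable (S.Z 0) μ)
    (hZpos : 0 < ∫ ω, S.Z 0 ω ∂μ) : ∀ᵐ ω ∂μ, S.RegularAt ω := by
  have hindep : Pairwise (Function.onFun (fun f g => IndepFun f g μ) S.Z) := fun i j hij =>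
    S.indep.indepFun (i := Sum.inr i) (j := Sum.inr j) (by simpa using hij)
  filter_upwards [ae_all_iff.2 S.X_nonneg, ae_all_iff.2 S.Z_nonneg,
    strong_law_ae_real S.Z hZ hindep S.identDistrib_Z] with ω h1 h2 h3
  refine ⟨h1, h2, (h3.pos_mul_atTop hZpos tendsto_natCast_atTop_atTop).congr' ?_⟩
  filter_upwards [eventually_gt_atTop 0] with n hn
  exact div_mul_cancel₀ _ (by exact_mod_cast hn.ne')

/-- The system with service times `0` and inter-arrival times `1` outside of a set of full
measure. -/
def modify (S : GIGI11System μ) {G : Set Ω} (hGm : MeasurableSet G) (hG : ∀ᵐ ω ∂μ, ω ∈ G) :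
    GIGI11System μ :=
  have hX : ∀ k, S.X k =ᵐ[μ] G.indicator (S.X k) := fun k => by
    filter_upwards [hG] with ω hω
    rw [Set.indicator_of_mem hω]
  have hZ : ∀ n, S.Z n =ᵐ[μ] G.indicator (S.Z n) + Gᶜ.indicator 1 := fun n => by
    filter_upwards [hG] with ω hω
    simp [hω]
  have hXm : ∀ k, Measurable (G.indicator (S.X k)) := fun k => (S.measurable_X k).indicator hGm
  have hZm : ∀ n, Measurable (G.indicator (S.Z n) + Gᶜ.indicator 1) := fun n =>
    ((S.measurable_Z n).indicator hGm).add (measurable_one.indicator hGm.compl)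
  { S with
    X := fun k => G.indicator (S.X k)
    Z := fun n => G.indicator (S.Z n) + Gᶜ.indicator 1
    measurable_X := hXm
    measurable_Z := hZm
    X_nonneg := fun k => by filter_upwards [S.X_nonneg k, hX k] with ω h1 h2 using h2 ▸ h1
    Z_nonneg := fun n => by filter_upwards [S.Z_nonneg n, hZ n] with ω h1 h2 using h2 ▸ h1
    indep := S.indep.congr fun i => by
      cases i with
      | inl k => exact hX k
      | inr n => exact hZ n
    identDistrib_X := fun k => ((IdentDistrib.of_ae_eq (hXm k).aemeasurable (hX k).symm).trans
      (S.identDistrib_X k)).trans (IdentDistrib.of_ae_eq (S.measurable_X 0).aemeasurable (hX 0))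
    identDistrib_Z := fun n => ((IdentDistrib.of_ae_eq (hZm n).aemeasurable (hZ n).symm).trans
      (S.identDistrib_Z n)).trans (IdentDistrib.of_ae_eq (S.measurable_Z 0).aemeasurable (hZ 0)) }

section modify

variable {G : Set Ω} (hGm : MeasurableSet G) (hG : ∀ᵐ ω ∂μ, ω ∈ G) {ω : Ω}

theorem modify_X (hω : ω ∈ G) (k : ℕ) : (S.modify hGm hG).X k ω = S.X k ω :=
  Set.indicator_of_mem hω _

theorem modify_Z (hω : ω ∈ G) (n : ℕ) : (S.modify hGm hG).Z n ω = S.Z n ω := by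
  simp [modify, hω]

theorem modify_renewal (hω : ω ∈ G) (n : ℕ) : (S.modify hGm hG).renewal n ω = S.renewal n ω :=
  Finset.sum_congr rfl fun i _ => modify_Z hGm hG hω i

theorem modify_streamArrival (hω : ω ∈ G) (n : ℕ) :
    (S.modify hGm hG).streamArrival n ω = S.streamArrival n ω := by
  rw [streamArrival_eq, streamArrival_eq, modify_renewal hGm hG hω]
  rfl

theorem modify_streamIndex (hω : ω ∈ G) (k : ℕ) :
    (S.modify hGm hG).streamIndex k ω = S.streamIndex k ω := by
  induction k with
  | zero => rfl
  | succ k ih =>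
    rw [streamIndex, streamIndex]
    simp only [ih, modify_streamArrival hGm hG hω, modify_X hGm hG hω]

theorem modify_arrivalTime (hω : ω ∈ G) (k : ℕ) :
    (S.modify hGm hG).arrivalTime k ω = S.arrivalTime k ω := by
  rw [arrivalTime, arrivalTime, modify_streamIndex hGm hG hω, modify_streamArrival hGm hG hω]

theorem modify_departureTime (hω : ω ∈ G) (k : ℕ) :
    (S.modify hGm hG).departureTime k ω = S.departureTime k ω := by
  rw [departureTime, departureTime, modify_arrivalTime hGm hG hω, modify_X hGm hG hω]

theorem modify_idleTime (hω : ω ∈ G) (k : ℕ) :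
    (S.modify hGm hG).idleTime k ω = S.idleTime k ω := by
  rw [idleTime, idleTime, modify_arrivalTime hGm hG hω, modify_departureTime hGm hG hω]

theorem modify_g (hω : ω ∈ G) (d : ℝ) (k : ℕ) : (S.modify hGm hG).g d k ω = S.g d k ω := by
  simp only [g, modify_idleTime hGm hG hω, modify_X hGm hG hω]

theorem modify_age (hω : ω ∈ G) (t : ℝ) : (S.modify hGm hG).age t ω = S.age t ω := by
  simp only [age, modify_arrivalTime hGm hG hω, modify_departureTime hGm hG hω]
  rfl

/-- The σ-algebras `past k n` need not contain the null sets, and the default value of `sInf`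
depends on the whole arrival stream. The stopping property thus calls for regularity at every sample
point; unit inter-arrival times off `G` provide it there. -/
theorem modify_regular (hreg : ∀ ω ∈ G, S.RegularAt ω) : (S.modify hGm hG).Regular := by
  intro ω
  by_cases hω : ω ∈ G
  · refine ⟨fun k => ?_, fun n => ?_, ?_⟩
    · rw [modify_X hGm hG hω]
      exact (hreg ω hω).X_nonneg k
    · rw [modify_Z hGm hG hω]
      exact (hreg ω hω).Z_nonneg n
    · simp only [modify_renewal hGm hG hω]
      exact (hreg ω hω).tendsto_renewal
  · have hZ : ∀ n, (S.modify hGm hG).Z n ω = 1 := fun n => by simp [modify, hω]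
    refine ⟨fun k => (Set.indicator_of_notMem hω _).ge, fun n => ?_, ?_⟩
    · rw [hZ]
      exact zero_le_one
    · simpa [renewal, hZ] using tendsto_natCast_atTop_atTop

end modify

end

end GIGI11System

theorem theorem4 {Ω : Type*} [MeasurableSpace Ω] (μ : Measure Ω) [IsProbabilityMeasure μ]
    (S : GIGI11System μ) (d : ℝ) (hd : 0 ≤ d)
    (hZ : Integrable (S.Z 0) μ) (hlam : 0 < S.arrivalRate)
    (hX : Integrable (S.X 0) μ) (hXpos : 0 < ∫ ω, S.X 0 ω ∂μ)
    (k : ℕ) (hk : 1 ≤ k) :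
    Integrable (S.idleTime k) μ ∧ Integrable (S.g d k) μ ∧
      (∀ᵐ ω ∂μ, Tendsto
        (fun T : ℝ => volume.real {t : ℝ | t ∈ Set.Icc 0 T ∧ d < S.age t ω} / T) atTop
        (𝓝 (S.departureRate k * ∫ ω', S.g d k ω' ∂μ))) ∧
      ∀ p : ℝ, S.HasViolationProbability d p →
        p = S.departureRate k * ∫ ω, S.g d k ω ∂μ := by
  have hZpos : 0 < ∫ ω, S.Z 0 ω ∂μ := one_div_pos.1 hlam
  obtain ⟨k, rfl⟩ := Nat.exists_eq_add_of_le' hk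
  obtain ⟨G, hG, hGm, hreg⟩ := (S.ae_regularAt hZ hZpos).exists_measurable_mem
  have hG' : ∀ᵐ ω ∂μ, ω ∈ G := hG
  set R := S.modify hGm hG' with hR
  have h : R.Regular := GIGI11System.modify_regular hGm hG' hreg
  have hXR : ∀ k, R.X k =ᵐ[μ] S.X k := fun k =>
    hG'.mono fun ω hω => GIGI11System.modify_X hGm hG' hω k
  have hZR : R.Z 0 =ᵐ[μ] S.Z 0 := hG'.mono fun ω hω => GIGI11System.modify_Z hGm hG' hω 0
  have hIR : R.idleTime (k + 1) =ᵐ[μ] S.idleTime (k + 1) :=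
    hG'.mono fun ω hω => GIGI11System.modify_idleTime hGm hG' hω _
  have hgR : R.g d (k + 1) =ᵐ[μ] S.g d (k + 1) :=
    hG'.mono fun ω hω => GIGI11System.modify_g hGm hG' hω d _
  have hX' : Integrable (R.X 0) μ := hX.congr (hXR 0).symm
  have hXpos' : 0 < ∫ ω, R.X 0 ω ∂μ := by rwa [integral_congr_ae (hXR 0)]
  have hI : Integrable (R.idleTime 1) μ :=
    h.integrable_idleTime_one (hZ.congr hZR.symm) (by rwa [integral_congr_ae hZR]) hX'
  -- The right-hand side no longer depends on `k`: all cycles have the law of the first.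
  have hlim : S.departureRate (k + 1) * ∫ ω, S.g d (k + 1) ω ∂μ =
      (∫ ω, R.g d 1 ω ∂μ) / ((∫ ω, R.X 0 ω ∂μ) + ∫ ω, R.idleTime 1 ω ∂μ) := by
    rw [← h.departureRate_mul_integral_g d k, GIGI11System.departureRate,
      GIGI11System.departureRate, integral_congr_ae (hXR (k + 1)), integral_congr_ae hIR,
      integral_congr_ae hgR]
  refine ⟨((h.identDistrib_idleTime k).integrable_iff.2 hI).congr hIR,
    ((h.identDistrib_g d k).integrable_iff.2 (h.integrable_g_one d hX' hI)).congr hgR, ?_, ?_⟩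
  · rw [hlim]
    filter_upwards [h.ae_tendsto_violation_time d hX' hXpos' hI, hG'] with ω hω hωG
    simpa only [hR, GIGI11System.modify_age hGm hG' hωG] using hω
  · intro p hp
    rw [hlim]
    refine h.eq_of_hasViolationProbability hX' hXpos' hI (hp.congr fun t => ?_)
    refine measureReal_congr (hG'.mono fun ω hω => ?_)
    exact congrArg (d < ·) (GIGI11System.modify_age hGm hG' hω t).symm
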